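/- All graphs are finite and simple. For a vertex $x$ of $G=(V,E)$ let $S(x)$ be the subgraph induced by the neighbors of $x$, and $G-x$ the subgraph induced by $V\setminus\{x\}$. Inductively, the one-point graph is contractible, and $G$ is contractible if for some vertex $x$ both $S(x)$ and $G-x$ are contractible. The empty graph is the $(-1)$-sphere; for $d\ge 0$, a $d$-manifold is a graph all of whose unit spheres $S(x)$ are $(d-1)$-spheres, and a $d$-sphere is a $d$-manifold $G$ such that $G-x$ is contractible for some vertex $x$. The Barycentric refinement $G_1$ has as vertices the (non-empty) complete subgraphs of $G$, two different ones being adjacent if one is contained in the other. The product $(A\times B)_1$ has as vertices the pairs $(x,y)$ of a (non-empty) complete subgraph $x$ of $A$ and a (non-empty) complete subgraph $y$ of $B$; different pairs $(x,y)$ and $(u,v)$ are adjacent if either $x\subseteq u$ and $y\subseteq v$, or $u\subseteq x$ and $v\subseteq y$. **Lemma.** (1) If $d\ge 0$ and $G$ is a non-empty $d$-manifold, then $G_1$ is a $d$-manifold and its chromatic number is $X(G_1)=d+1$. (2) More generally, if $p,q\ge 0$, $A$ is a non-empty $p$-manifold and $B$ is a non-empty $q$-manifold, then $(A\times B)_1$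 is a $(p+q)$-manifold and its chromatic number is $X((A\times B)_1)=p+q+1$. -/

import Mathlib

namespace KnillGraph

universe u v

/-- The unit sphere `S(x)`: the subgraph induced by the neighbours of `x`. -/
abbrev unitSphere {V : Type u} (G : SimpleGraph V) (x : V) : SimpleGraph (G.neighborSet x) :=
  G.induce (G.neighborSet x)

/-- The graph `G - x`: the subgraph induced by all vertices different from `x`. -/
abbrev deleteVertex {V : Type u} (G : SimpleGraph V) (x : V) :
    SimpleGraph (({x} : Set V)ᶜ : Set V) :=
  G.induce ({x} : Set V)ᶜ

/-- Contractible graphs: the one-point graph is contractible, and `G` is contractible as soon as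
for some vertex `x` both `S(x)` and `G - x` are contractible. (Such a graph is always finite.) -/
inductive IsContractible : {V : Type u} → SimpleGraph V → Prop
  | point {V : Type u} (G : SimpleGraph V) (h : Nat.card V = 1) : IsContractible G
  | step {V : Type u} (G : SimpleGraph V) (x : V)
      (hS : IsContractible (unitSphere G x)) (hD : IsContractible (deleteVertex G x)) :
      IsContractible G

/-- `IsSphereSucc n G` says that `G` is an `(n - 1)`-sphere; the index is shifted by one because
dimensions start at `-1`. The `(-1)`-sphere is the empty graph; for `n ≥ 0`, an `n`-sphere is an
`n`-manifold (a finite graph all of whose unit spheres are `(n - 1)`-spheres) such that `G - x` is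
contractible for some vertex `x`. -/
def IsSphereSucc : ℕ → {V : Type u} → SimpleGraph V → Prop
  | 0, V, _ => IsEmpty V
  | n + 1, V, G =>
      (Finite V ∧ ∀ x : V, IsSphereSucc n (unitSphere G x)) ∧
        ∃ x : V, IsContractible (deleteVertex G x)

/-- A `d`-manifold (`d ≥ 0`): a finite simple graph all of whose unit spheres are
`(d - 1)`-spheres. -/
def IsManifold (d : ℕ) {V : Type u} (G : SimpleGraph V) : Prop :=
  Finite V ∧ ∀ x : V, IsSphereSucc d (unitSphere G x)

/-- A `d`-sphere (`d ≥ 0`) is exactly a `d`-manifold such that removing some vertex leaves a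
contractible graph. -/
theorem isSphereSucc_succ_iff (d : ℕ) {V : Type u} (G : SimpleGraph V) :
    IsSphereSucc (d + 1) G ↔ IsManifold d G ∧ ∃ x : V, IsContractible (deleteVertex G x) :=
  Iff.rfl

/-- The complete subgraphs (nonempty cliques) of `G`, given by their vertex sets: the simplices
of the Whitney complex. -/
abbrev CompleteSubgraph {V : Type u} (G : SimpleGraph V) : Type u :=
  {s : Finset V // s.Nonempty ∧ G.IsClique (s : Set V)}

/-- The Barycentric refinement `G_1`: its vertices are the complete subgraphs of `G`, and two
different ones are adjacent if one is contained in the other. -/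
def barycentricRefinement {V : Type u} (G : SimpleGraph V) : SimpleGraph (CompleteSubgraph G) where
  Adj x u := x ≠ u ∧ (x.1 ⊆ u.1 ∨ u.1 ⊆ x.1)
  symm := ⟨fun _ _ h => ⟨h.1.symm, h.2.symm⟩⟩
  loopless := ⟨fun _ h => h.1 rfl⟩

/-- The product `(A × B)_1`: its vertices are the pairs `(x, y)` of a complete subgraph `x` of `A`
and a complete subgraph `y` of `B`; different pairs `(x, y)` and `(u, v)` are adjacent if
`x ⊆ u` and `y ⊆ v`, or `u ⊆ x` and `v ⊆ y`. -/
def cartesianProduct {V : Type u} {W : Type v} (A : SimpleGraph V) (B : SimpleGraph W) :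
    SimpleGraph (CompleteSubgraph A × CompleteSubgraph B) where
  Adj a b := a ≠ b ∧
    ((a.1.1 ⊆ b.1.1 ∧ a.2.1 ⊆ b.2.1) ∨ (b.1.1 ⊆ a.1.1 ∧ b.2.1 ⊆ a.2.1))
  symm := ⟨fun _ _ h => ⟨h.1.symm, h.2.symm⟩⟩
  loopless := ⟨fun _ h => h.1 rfl⟩

end KnillGraph

namespace KnillGraph

open Set

/-! The graph `(A × B)_1` is the comparability graph of the poset of pairs of nonempty cliques under
componentwise inclusion, so the unit sphere of `(x, y)` is the join of the part strictly below with
the part strictly above. Complementation `(u, v) ↦ (x \ u, y \ v)` turns the lower part, upside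
down, into the nonempty faces of `∂x * ∂y`; the upper part is the poset of nonempty faces of `lk x *
lk y` (`lower_cliquePairs`, `upper_cliquePairs`). Boundaries of simplices, links of faces in a
manifold and joins of spheres are spheres, and barycentric subdivision keeps spheres; the dimensions
add up to `p + q - 1`.

The boundary of a triangle is not a clique complex, so these facts are proved for simplicial
complexes, with non-evasiveness in place of contractibility. Spheres pass from graphs to clique
complexes by `SphereOn.isSphereComplex`, and come back as comparability graphs of faces by
`IsSphereComplex.sphereOn_faces`.

For the chromatic number, `|x| + |y| - 2` is strictly monotone on the poset and hence a proper
coloring with `p + q + 1` colors, while every non-empty `d`-manifold contains a `(d + 1)`-clique.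
The statement on `G_1` is the product with the one-point manifold. -/

/-- The set `s` of vertices of `G` induces a contractible subgraph. -/
inductive ContractibleOn {β : Type*} (G : SimpleGraph β) : Set β → Prop
  | point (x : β) : ContractibleOn G {x}
  | step (s : Set β) (x : β) (hx : x ∈ s) (hS : ContractibleOn G (s ∩ G.neighborSet x))
      (hD : ContractibleOn G (s \ {x})) : ContractibleOn G s

/-- The set `s` of vertices of `G` induces an `(n - 1)`-sphere. -/
def SphereOn {β : Type*} (G : SimpleGraph β) : ℕ → Set β → Prop
  | 0, s => s = ∅
  | n + 1, s => (∀ x ∈ s, SphereOn G n (s ∩ G.neighborSet x)) ∧ ∃ x ∈ s, ContractibleOn G (s \ {x})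

/-! ### Passing between induced subgraphs and vertex sets of one ambient graph -/

section Transfer

variable {V β : Type*} {G : SimpleGraph V} {H : SimpleGraph β}

theorem range_comp_unitSphere (e : G ↪g H) (x : V) :
    range (e.comp (SimpleGraph.Embedding.induce (G.neighborSet x))) =
      range e ∩ H.neighborSet (e x) := by
  ext b
  constructor
  · rintro ⟨y, rfl⟩
    exact ⟨⟨y, rfl⟩, e.map_adj_iff.2 y.2⟩
  · rintro ⟨⟨y, rfl⟩, hy⟩
    exact ⟨⟨y, e.map_adj_iff.1 hy⟩, rfl⟩

theorem range_comp_deleteVertex (e : G ↪g H) (x : V) :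
    range (e.comp (SimpleGraph.Embedding.induce ({x}ᶜ : Set V))) = range e \ {e x} := by
  ext b
  constructor
  · rintro ⟨y, rfl⟩
    exact ⟨⟨y, rfl⟩, fun h => y.2 (e.injective h)⟩
  · rintro ⟨⟨y, rfl⟩, hy⟩
    exact ⟨⟨y, fun h => hy (congrArg e h)⟩, rfl⟩

theorem IsContractible.contractibleOn (h : IsContractible G) (e : G ↪g H) :
    ContractibleOn H (range e) := by
  induction h with
  | point G h =>
    obtain ⟨hs, ⟨x⟩⟩ := Nat.card_eq_one_iff_unique.1 h
    have : range e = {e x} := by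
      ext b
      constructor
      · rintro ⟨y, rfl⟩
        exact congrArg e (Subsingleton.elim y x)
      · rintro rfl
        exact ⟨x, rfl⟩
    exact this ▸ .point _
  | step G x _ _ ihS ihD =>
    refine .step _ (e x) ⟨x, rfl⟩ ?_ ?_
    · rw [← range_comp_unitSphere]
      exact ihS _
    · rw [← range_comp_deleteVertex]
      exact ihD _

/-- All embeddings with range `s` are considered at once, because the recursion moves to subgraphs
whose vertex types change. -/
theorem ContractibleOn.isContractible {s : Set β} (h : ContractibleOn H s) :
    ∀ {V : Type*} {G : SimpleGraph V} (e : G ↪g H), range e = s → IsContractible G := by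
  induction h with
  | point b =>
    intro V G e he
    refine .point G (Nat.card_eq_one_iff_unique.2 ⟨⟨fun x y => e.injective ?_⟩, ?_⟩)
    · have hx : e x ∈ ({b} : Set β) := he ▸ ⟨x, rfl⟩
      have hy : e y ∈ ({b} : Set β) := he ▸ ⟨y, rfl⟩
      exact hx.trans hy.symm
    · have hb : b ∈ range e := he ▸ rfl
      exact ⟨hb.choose⟩
  | step s b hb _ _ ihS ihD =>
    rintro V G e rfl
    obtain ⟨x, rfl⟩ := hb
    exact .step G x (ihS _ (range_comp_unitSphere e x)) (ihD _ (range_comp_deleteVertex e x))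

theorem isContractible_iff (e : G ↪g H) : IsContractible G ↔ ContractibleOn H (range e) :=
  ⟨fun h => h.contractibleOn e, fun h => h.isContractible e rfl⟩

theorem isSphereSucc_iff (n : ℕ) : ∀ {V : Type*} [Finite V] {G : SimpleGraph V} (e : G ↪g H),
    IsSphereSucc n G ↔ SphereOn H n (range e) := by
  induction n with
  | zero => intro V _ G e; simp [IsSphereSucc, SphereOn, range_eq_empty_iff]
  | succ n ih =>
    intro V hV G e
    simp only [IsSphereSucc, SphereOn, forall_mem_range, exists_range_iff, hV, true_and,
      ← range_comp_unitSphere, ← range_comp_deleteVertex, ← isContractible_iff, ← ih]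

theorem isManifold_iff [Finite V] (d : ℕ) (e : G ↪g H) :
    IsManifold d G ↔ ∀ x ∈ range e, SphereOn H d (range e ∩ H.neighborSet x) := by
  simp only [IsManifold, forall_mem_range, ‹Finite V›, true_and, ← range_comp_unitSphere,
    ← isSphereSucc_iff]

end Transfer

/-! ### Cones, joins and cliques in graphs -/

section Graph

variable {β γ : Type*} {G : SimpleGraph β} {H : SimpleGraph γ}

theorem image_inter_neighborSet {s : Set β} {f : β → γ}
    (ha : ∀ x ∈ s, ∀ y ∈ s, (H.Adj (f x) (f y) ↔ G.Adj x y)) {x : β} (hx : x ∈ s) :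
    f '' (s ∩ G.neighborSet x) = f '' s ∩ H.neighborSet (f x) := by
  ext b
  constructor
  · rintro ⟨y, ⟨hy, hxy⟩, rfl⟩
    exact ⟨⟨y, hy, rfl⟩, (ha x hx y hy).2 hxy⟩
  · rintro ⟨⟨y, hy, rfl⟩, hxy⟩
    exact ⟨y, ⟨hy, (ha x hx y hy).1 hxy⟩, rfl⟩

theorem image_diff_singleton_of_injOn {s : Set β} {f : β → γ} (hf : InjOn f s) {x : β}
    (hx : x ∈ s) : f '' (s \ {x}) = f '' s \ {f x} := by
  rw [hf.image_sdiff_subset (singleton_subset_iff.2 hx), image_singleton]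

theorem ContractibleOn.image {s : Set β} (h : ContractibleOn G s) {f : β → γ} (hf : InjOn f s)
    (ha : ∀ x ∈ s, ∀ y ∈ s, (H.Adj (f x) (f y) ↔ G.Adj x y)) : ContractibleOn H (f '' s) := by
  induction h with
  | point x => rw [image_singleton]; exact .point _
  | step s x hx _ _ ihS ihD =>
    refine .step _ (f x) ⟨x, hx, rfl⟩ ?_ ?_
    · rw [← image_inter_neighborSet ha hx]
      exact ihS (hf.mono inter_subset_left) fun y hy z hz => ha y hy.1 z hz.1
    · rw [← image_diff_singleton_of_injOn hf hx]
      exact ihD (hf.mono sdiff_subset) fun y hy z hz => ha y hy.1 z hz.1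

theorem SphereOn.image {n : ℕ} {s : Set β} (h : SphereOn G n s) {f : β → γ} (hf : InjOn f s)
    (ha : ∀ x ∈ s, ∀ y ∈ s, (H.Adj (f x) (f y) ↔ G.Adj x y)) : SphereOn H n (f '' s) := by
  induction n generalizing s with
  | zero =>
    have h : s = ∅ := h
    simp [SphereOn, h]
  | succ n ih =>
    obtain ⟨hS, x, hx, hD⟩ := h
    refine ⟨forall_mem_image.2 fun y hy => ?_, f x, ⟨x, hx, rfl⟩, ?_⟩
    · rw [← image_inter_neighborSet ha hy]
      exact ih (hS y hy) (hf.mono inter_subset_left) fun y hy z hz => ha y hy.1 z hz.1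
    · rw [← image_diff_singleton_of_injOn hf hx]
      exact hD.image (hf.mono sdiff_subset) fun y hy z hz => ha y hy.1 z hz.1

/-- For a vertex other than the apex, both its unit sphere and its deletion are smaller cones with
the same apex. -/
theorem contractibleOn_of_cone {s : Set β} (hs : s.Finite) {a : β} (has : a ∈ s)
    (h : ∀ x ∈ s, x ≠ a → G.Adj a x) : ContractibleOn G s := by
  induction hn : s.ncard using Nat.strong_induction_on generalizing s with
  | _ n ih =>
    subst hn
    by_cases hx : ∃ x ∈ s, x ≠ a
    · obtain ⟨x, hx, hxa⟩ := hx
      have key : ∀ t ⊆ s, x ∉ t → a ∈ t → ContractibleOn G t := fun t ht hxt hat =>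
        ih _ (ncard_lt_ncard ⟨ht, fun h' => hxt (h' hx)⟩ hs) (hs.subset ht) hat
          (fun y hy => h y (ht hy)) rfl
      exact .step s x hx (key _ inter_subset_left (fun h => G.loopless.irrefl _ h.2)
        ⟨has, (h x hx hxa).symm⟩) (key _ sdiff_subset (fun h => h.2 rfl) ⟨has, hxa.symm⟩)
    · push Not at hx
      rw [eq_singleton_iff_unique_mem.2 ⟨has, hx⟩]
      exact .point a

theorem union_inter_neighborSet {s t : Set β} (h : ∀ x ∈ s, ∀ y ∈ t, G.Adj x y) {x : β}
    (hx : x ∈ s) : (s ∪ t) ∩ G.neighborSet x = (s ∩ G.neighborSet x) ∪ t := by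
  ext y
  have := h x hx y
  simp only [mem_inter_iff, mem_union, SimpleGraph.mem_neighborSet]
  tauto

theorem union_diff_singleton_of_adj {s t : Set β} (h : ∀ x ∈ s, ∀ y ∈ t, G.Adj x y) {x : β}
    (hx : x ∈ s) : (s ∪ t) \ {x} = (s \ {x}) ∪ t := by
  rw [union_sdiff_distrib, sdiff_singleton_eq_self fun hxt => G.loopless.irrefl _ (h x hx x hxt)]

/-- A contraction of `s` is performed with `t` carried along; once `s` is a single point, the join
is a cone. -/
theorem ContractibleOn.union {s t : Set β} (hs : ContractibleOn G s) (ht : t.Finite)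
    (h : ∀ x ∈ s, ∀ y ∈ t, G.Adj x y) : ContractibleOn G (s ∪ t) := by
  induction hs with
  | point x =>
    refine contractibleOn_of_cone (a := x) ((finite_singleton x).union ht) (.inl rfl) ?_
    rintro y (rfl | hy) hyx
    · exact absurd rfl hyx
    · exact h x rfl y hy
  | step s x hx _ _ ihS ihD =>
    refine .step _ x (.inl hx) ?_ ?_
    · rw [union_inter_neighborSet h hx]
      exact ihS fun y hy => h y hy.1
    · rw [union_diff_singleton_of_adj h hx]
      exact ihD fun y hy => h y hy.1

/-- The indices are dimensions plus one, which is why they simply add under joins. -/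
theorem SphereOn.union {m n : ℕ} {s t : Set β} (hs : SphereOn G m s) (ht : SphereOn G n t)
    (htf : t.Finite) (h : ∀ x ∈ s, ∀ y ∈ t, G.Adj x y) : SphereOn G (m + n) (s ∪ t) := by
  induction hN : m + n generalizing m n s t with
  | zero =>
    obtain ⟨rfl, rfl⟩ : m = 0 ∧ n = 0 := by omega
    have hs : s = ∅ := hs
    have ht : t = ∅ := ht
    simp [SphereOn, hs, ht]
  | succ N ih =>
    match m, n with
    | 0, n =>
      have hs : s = ∅ := hs
      obtain rfl : n = N + 1 := by omega
      simpa [hs] using ht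
    | m, 0 =>
      have ht : t = ∅ := ht
      obtain rfl : m = N + 1 := by omega
      simpa [ht] using hs
    | m + 1, n + 1 =>
      refine ⟨?_, ?_⟩
      · rintro x (hx | hx)
        · rw [union_inter_neighborSet h hx]
          exact ih (hs.1 x hx) ht htf (fun y hy => h y hy.1) (by omega)
        · rw [union_comm, union_inter_neighborSet (fun y hy z hz => (h z hz y hy).symm) hx,
            union_comm]
          exact ih hs (ht.1 x hx) (htf.inter_of_left _) (fun y hy z hz => h y hy z hz.1)
            (by omega)
      · obtain ⟨x, hx, hD⟩ := hs.2
        refine ⟨x, .inl hx, ?_⟩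
        rw [union_diff_singleton_of_adj h hx]
        exact hD.union htf fun y hy => h y hy.1

/-- Adding `x` to a clique of `S(x)` raises the size by one. This gives the lower bound for the
chromatic number. -/
theorem SphereOn.exists_isClique {n : ℕ} {s : Set β} (h : SphereOn G n s) :
    ∃ t : Finset β, (t : Set β) ⊆ s ∧ G.IsNClique n t := by
  classical
  induction n generalizing s with
  | zero => exact ⟨∅, by simp, by simp⟩
  | succ n ih =>
    obtain ⟨hS, x, hx, -⟩ := h
    obtain ⟨t, hts, ht⟩ := ih (hS x hx)
    refine ⟨insert x t, ?_, ht.insert fun y hy => (hts hy).2⟩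
    rw [Finset.coe_insert]
    exact insert_subset hx fun y hy => (hts hy).1

end Graph

/-! ### Comparability graphs of posets -/

section Order

variable {P : Type*} [PartialOrder P]

/-- The comparability graph of a partial order. -/
def comparabilityGraph (P : Type*) [PartialOrder P] : SimpleGraph P where
  Adj a b := a < b ∨ b < a
  symm := ⟨fun _ _ h => h.symm⟩
  loopless := ⟨fun a h => lt_irrefl a (h.elim id id)⟩

theorem inter_neighborSet_comparabilityGraph (s : Set P) (x : P) :
    s ∩ (comparabilityGraph P).neighborSet x = {y ∈ s | y < x} ∪ {y ∈ s | x < y} := by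
  ext y
  change y ∈ s ∧ (x < y ∨ y < x) ↔ (y ∈ s ∧ y < x) ∨ (y ∈ s ∧ x < y)
  tauto

theorem adj_of_mem_lower_of_mem_upper {s : Set P} {x : P} :
    ∀ y ∈ {y ∈ s | y < x}, ∀ z ∈ {y ∈ s | x < y}, (comparabilityGraph P).Adj y z :=
  fun _ hy _ hz => .inl (hy.2.trans hz.2)

theorem SphereOn.inter_neighborSet [Finite P] {m n : ℕ} {s : Set P} {x : P}
    (hl : SphereOn (comparabilityGraph P) m {y ∈ s | y < x})
    (hu : SphereOn (comparabilityGraph P) n {y ∈ s | x < y}) :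
    SphereOn (comparabilityGraph P) (m + n) (s ∩ (comparabilityGraph P).neighborSet x) := by
  rw [inter_neighborSet_comparabilityGraph]
  exact hl.union hu (toFinite _) adj_of_mem_lower_of_mem_upper

/-- Contractibility can be checked after removing, in increasing order, elements whose remaining
lower link is contractible. -/
theorem ContractibleOn.of_diff [Finite P] {s r : Set P} (hr : r ⊆ s)
    (hl : ∀ x ∈ r, ContractibleOn (comparabilityGraph P) {y ∈ s \ r | y < x})
    (h : ContractibleOn (comparabilityGraph P) (s \ r)) :
    ContractibleOn (comparabilityGraph P) s := by
  induction hn : r.ncard generalizing s r with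
  | zero =>
    obtain rfl : r = ∅ := (ncard_eq_zero (toFinite r)).1 hn
    simpa using h
  | succ n ih =>
    have hne : r.Nonempty := nonempty_of_ncard_ne_zero (by omega)
    obtain ⟨x, hx⟩ := (toFinite r).exists_minimal hne
    have hdiff : (s \ {x}) \ (r \ {x}) = s \ r := by
      ext y
      have : y = x → y ∈ r := fun h => h ▸ hx.1
      simp only [mem_sdiff, mem_singleton_iff]
      tauto
    refine .step s x (hr hx.1) ?_ ?_
    · rw [inter_neighborSet_comparabilityGraph]
      refine ContractibleOn.union ?_ (toFinite _) adj_of_mem_lower_of_mem_upper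
      convert hl x hx.1 using 1
      ext y
      -- By minimality nothing of `r` lies below `x`, so its lower link in `s` is already the one in
      -- `s \ r`.
      have : y < x → y ∉ r := fun hyx hy => hyx.not_ge (hx.2 hy hyx.le)
      simp only [mem_ofPred_eq, mem_sdiff]
      tauto
    · refine ih (r := r \ {x}) (sdiff_subset_sdiff_left hr) (fun z hz => ?_) (hdiff.symm ▸ h) ?_
      · rw [hdiff]
        exact hl z hz.1
      · rw [ncard_sdiff_singleton_of_mem hx.1]
        omega

end Order

/-! ### Simplicial complexes: non-evasiveness, spheres, joins and links -/

section Complex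

variable {α β : Type*}

/-- A family of finite sets is an abstract simplicial complex, with the empty set as a member. -/
structure IsComplex (K : Set (Finset α)) : Prop where
  empty_mem : ∅ ∈ K
  mem_of_subset : ∀ {s t : Finset α}, t ∈ K → s ⊆ t → s ∈ K

/-- The deletion of a vertex from a complex. -/
def deletion (K : Set (Finset α)) (x : α) : Set (Finset α) :=
  {t | x ∉ t ∧ t ∈ K}

variable [DecidableEq α] [DecidableEq β]

/-- The link of a vertex in a complex. -/
def link (K : Set (Finset α)) (x : α) : Set (Finset α) :=
  {t | x ∉ t ∧ insert x t ∈ K}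

/-- Non-evasive complexes: points, and complexes with a vertex whose link and deletion are
non-evasive. -/
inductive Nonevasive : Set (Finset α) → Prop
  | point (x : α) : Nonevasive {∅, {x}}
  | step (K : Set (Finset α)) (x : α) (hx : {x} ∈ K) (hS : Nonevasive (link K x))
      (hD : Nonevasive (deletion K x)) : Nonevasive K

/-- A complex is an `(n - 1)`-sphere, in the sense corresponding to `IsSphereSucc`. -/
def IsSphereComplex : ℕ → Set (Finset α) → Prop
  | 0, K => K = {∅}
  | n + 1, K => (∀ x, {x} ∈ K → IsSphereComplex n (link K x)) ∧
      ∃ x, {x} ∈ K ∧ Nonevasive (deletion K x)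

theorem IsComplex.link {K : Set (Finset α)} (hK : IsComplex K) {x : α} (hx : {x} ∈ K) :
    IsComplex (link K x) where
  empty_mem := ⟨by simp, by simpa using hx⟩
  mem_of_subset ht hst := ⟨fun h => ht.1 (hst h),
    hK.mem_of_subset ht.2 (Finset.insert_subset_insert x hst)⟩

omit [DecidableEq α] in
theorem IsComplex.deletion {K : Set (Finset α)} (hK : IsComplex K) (x : α) :
    IsComplex (deletion K x) where
  empty_mem := ⟨by simp, hK.empty_mem⟩
  mem_of_subset ht hst := ⟨fun h => ht.1 (hst h), hK.mem_of_subset ht.2 hst⟩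

theorem IsComplex.erase_mem_link {K : Set (Finset α)} {x : α} {s : Finset α} (hs : s ∈ K)
    (hx : x ∈ s) : s.erase x ∈ KnillGraph.link K x :=
  ⟨by simp, by rwa [Finset.insert_erase hx]⟩

theorem IsComplex.link_subset {K : Set (Finset α)} (hK : IsComplex K) (x : α) :
    KnillGraph.link K x ⊆ K :=
  fun _ ht => hK.mem_of_subset ht.2 (Finset.subset_insert _ _)

theorem nonevasive_of_cone [Finite α] {K : Set (Finset α)} (hK : IsComplex K) {a : α}
    (h : ∀ t ∈ K, insert a t ∈ K) : Nonevasive K := by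
  induction hn : {x | {x} ∈ K}.ncard using Nat.strong_induction_on generalizing K with
  | _ n ih =>
    subst hn
    have ha : {a} ∈ K := h ∅ hK.empty_mem
    by_cases hx : ∃ x, {x} ∈ K ∧ x ≠ a
    · obtain ⟨x, hx, hxa⟩ := hx
      have key : ∀ L ⊆ K, {x} ∉ L → IsComplex L → (∀ t ∈ L, insert a t ∈ L) → Nonevasive L :=
        fun L hLK hxL hL hc => ih _ (ncard_lt_ncard ⟨fun y hy => hLK hy, fun h' => hxL (h' hx)⟩
          (toFinite _)) hL hc rfl
      refine .step K x hx (key _ (hK.link_subset x) (fun h => h.1 (by simp)) (hK.link hx) ?_)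
        (key _ (fun t ht => ht.2) (fun h => h.1 (by simp)) (hK.deletion x) ?_)
      · rintro t ⟨hxt, ht⟩
        exact ⟨by simp [hxt, hxa], Finset.insert_comm a x t ▸ h _ ht⟩
      · rintro t ⟨hxt, ht⟩
        exact ⟨by simp [hxt, hxa], h _ ht⟩
    · push Not at hx
      have : K = {∅, {a}} := by
        ext t
        constructor
        · intro ht
          refine Finset.subset_singleton_iff.1 fun x hxt => Finset.mem_singleton.2 (hx x ?_)
          exact hK.mem_of_subset ht (by simpa using hxt)
        · rintro (rfl | rfl)
          exacts [hK.empty_mem, ha]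
      exact this ▸ .point a

omit [DecidableEq α] in
theorem isComplex_boundary {s : Finset α} (hs : s.Nonempty) : IsComplex {t | t ⊂ s} where
  empty_mem := Finset.empty_ssubset.2 hs
  mem_of_subset ht hst := hst.trans_ssubset ht

/-- The link of `x` in `∂s` is the boundary of `s.erase x`, and its deletion is the full simplex on
`s.erase x`, a cone over any other vertex `y`. -/
theorem isSphereComplex_boundary [Finite α] {n : ℕ} {s : Finset α} (hs : s.card = n + 1) :
    IsSphereComplex n {t | t ⊂ s} := by
  induction n generalizing s with
  | zero =>
    obtain ⟨x, rfl⟩ := Finset.card_eq_one.1 hs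
    change _ = _
    ext t
    simp [Finset.ssubset_singleton_iff]
  | succ n ih =>
    refine ⟨fun x hx => ?_, ?_⟩
    · have hxs : x ∈ s := by simpa using hx.1
      have : link {t | t ⊂ s} x = {t | t ⊂ s.erase x} := by
        ext t
        change (x ∉ t ∧ insert x t ⊂ s) ↔ t ⊂ s.erase x
        by_cases hxt : x ∈ t
        · simp only [hxt, not_true, false_and, false_iff]
          exact fun h => (Finset.notMem_erase x s) (h.1 hxt)
        · rw [← Finset.insert_erase hxs, Finset.erase_insert (Finset.notMem_erase x s),
            Finset.ssubset_def, Finset.ssubset_def,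
            Finset.insert_subset_insert_iff hxt,
            Finset.insert_subset_insert_iff (Finset.notMem_erase x s)]
          simp [hxt]
      rw [this]
      exact ih (by rw [Finset.card_erase_of_mem hxs, hs]; rfl)
    · obtain ⟨x, hx, y, hy, hxy⟩ := Finset.one_lt_card.1 (by omega : 1 < s.card)
      refine ⟨x, ⟨by simpa using hx, fun h => hxy ?_⟩, ?_⟩
      · exact (Finset.mem_singleton.1 (h hy)).symm
      · refine nonevasive_of_cone
          ((isComplex_boundary ⟨x, hx⟩).deletion x) (a := y) fun t ht => ?_
        have hxt : x ∉ insert y t := by simp [hxy, ht.1]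
        exact ⟨hxt, Finset.insert_subset hy ht.2.1, fun h => hxt (h hx)⟩

/-- The join of two complexes. -/
def join (K : Set (Finset α)) (L : Set (Finset β)) : Set (Finset (α ⊕ β)) :=
  {t | t.toLeft ∈ K ∧ t.toRight ∈ L}

omit [DecidableEq α] [DecidableEq β] in
theorem IsComplex.join {K : Set (Finset α)} {L : Set (Finset β)} (hK : IsComplex K)
    (hL : IsComplex L) : IsComplex (join K L) where
  empty_mem := ⟨hK.empty_mem, hL.empty_mem⟩
  mem_of_subset ht hst := ⟨hK.mem_of_subset ht.1 (Finset.toLeft_subset_toLeft hst),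
    hL.mem_of_subset ht.2 (Finset.toRight_subset_toRight hst)⟩

theorem link_join_inl (K : Set (Finset α)) (L : Set (Finset β)) (x : α) :
    link (join K L) (.inl x) = join (link K x) L := by
  ext t
  simp [link, join, and_assoc]

theorem link_join_inr (K : Set (Finset α)) (L : Set (Finset β)) (y : β) :
    link (join K L) (.inr y) = join K (link L y) := by
  ext t
  simp [link, join]
  tauto

omit [DecidableEq α] [DecidableEq β] in
theorem deletion_join_inl (K : Set (Finset α)) (L : Set (Finset β)) (x : α) :
    deletion (join K L) (.inl x) = join (deletion K x) L := by
  ext t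
  simp [deletion, join, and_assoc]

omit [DecidableEq α] [DecidableEq β] in
theorem singleton_inl_mem_join {K : Set (Finset α)} {L : Set (Finset β)} (hL : IsComplex L)
    {x : α} : {.inl x} ∈ join K L ↔ {x} ∈ K := by
  have h1 : ({.inl x} : Finset (α ⊕ β)).toLeft = {x} := by ext; simp
  have h2 : ({.inl x} : Finset (α ⊕ β)).toRight = ∅ := by ext; simp
  simp [join, h1, h2, hL.empty_mem]

omit [DecidableEq α] [DecidableEq β] in
theorem singleton_inr_mem_join {K : Set (Finset α)} {L : Set (Finset β)} (hK : IsComplex K)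
    {y : β} : {.inr y} ∈ join K L ↔ {y} ∈ L := by
  have h1 : ({.inr y} : Finset (α ⊕ β)).toRight = {y} := by ext; simp
  have h2 : ({.inr y} : Finset (α ⊕ β)).toLeft = ∅ := by ext; simp
  simp [join, h1, h2, hK.empty_mem]

omit [DecidableEq α] in
theorem isComplex_point (x : α) : IsComplex {∅, {x}} where
  empty_mem := .inl rfl
  mem_of_subset := by
    rintro s t (rfl | rfl) hst
    · exact .inl (Finset.subset_empty.1 hst)
    · exact Finset.subset_singleton_iff.1 hst

theorem Nonevasive.join [Finite α] [Finite β] {K : Set (Finset α)} {L : Set (Finset β)}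
    (h : Nonevasive K) (hL : IsComplex L) : Nonevasive (join K L) := by
  induction h with
  | point x =>
    refine nonevasive_of_cone ((isComplex_point x).join hL) (a := .inl x) fun t ht => ?_
    refine ⟨?_, by simpa using ht.2⟩
    rw [Finset.toLeft_insert_inl]
    rcases ht.1 with h | h
    · rw [h]; exact .inr rfl
    · rw [h]; exact .inr (by simp)
  | step K x hx _ _ ihS ihD =>
    refine .step _ (.inl x) ((singleton_inl_mem_join hL).2 hx) ?_ ?_
    · rwa [link_join_inl]
    · rwa [deletion_join_inl]

omit [DecidableEq α] [DecidableEq β] in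
theorem deletion_join_inr (K : Set (Finset α)) (L : Set (Finset β)) (y : β) :
    deletion (join K L) (.inr y) = join K (deletion L y) := by
  ext t
  simp [deletion, join]
  tauto

/-- Needed for joins of spheres whose left factor is the `(-1)`-sphere, which has no vertex to
delete. -/
theorem Nonevasive.join_right [Finite α] [Finite β] {K : Set (Finset α)} {L : Set (Finset β)}
    (hK : IsComplex K) (h : Nonevasive L) : Nonevasive (KnillGraph.join K L) := by
  induction h with
  | point y =>
    refine nonevasive_of_cone (hK.join (isComplex_point y)) (a := .inr y) fun t ht => ?_
    refine ⟨by simpa using ht.1, ?_⟩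
    rw [Finset.toRight_insert_inr]
    rcases ht.2 with h | h
    · rw [h]; exact .inr rfl
    · rw [h]; exact .inr (by simp)
  | step L y hy _ _ ihS ihD =>
    refine .step _ (.inr y) ((singleton_inr_mem_join hK).2 hy) ?_ ?_
    · rwa [link_join_inr]
    · rwa [deletion_join_inr]

theorem IsSphereComplex.join [Finite α] [Finite β] {m n : ℕ} {K : Set (Finset α)}
    {L : Set (Finset β)} (hK : IsComplex K) (hL : IsComplex L) (h : IsSphereComplex m K)
    (h' : IsSphereComplex n L) : IsSphereComplex (m + n) (KnillGraph.join K L) := by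
  induction hN : m + n generalizing m n K L with
  | zero =>
    obtain ⟨rfl, rfl⟩ : m = 0 ∧ n = 0 := by omega
    have h : K = {∅} := h
    have h' : L = {∅} := h'
    subst h h'
    change _ = _
    ext t
    change t.toLeft = ∅ ∧ t.toRight = ∅ ↔ t = ∅
    simpa [eq_comm] using (Finset.eq_disjSum_iff (u := t) (s := ∅) (t := ∅)).symm
  | succ N ih =>
    refine ⟨?_, ?_⟩
    · rintro (x | y) hxy
      · rw [singleton_inl_mem_join hL] at hxy
        rw [link_join_inl]
        match m with
        | 0 =>
          have h : K = {∅} := h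
          simp [h] at hxy
        | m + 1 => exact ih (hK.link hxy) hL (h.1 x hxy) h' (by omega)
      · rw [singleton_inr_mem_join hK] at hxy
        rw [link_join_inr]
        match n with
        | 0 =>
          have h' : L = {∅} := h'
          simp [h'] at hxy
        | n + 1 => exact ih hK (hL.link hxy) h (h'.1 y hxy) (by omega)
    · match m, n with
      | m + 1, n =>
        obtain ⟨x, hx, hD⟩ := h.2
        refine ⟨.inl x, (singleton_inl_mem_join hL).2 hx, ?_⟩
        rw [deletion_join_inl]
        exact hD.join hL
      | m, n + 1 =>
        obtain ⟨y, hy, hD⟩ := h'.2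
        refine ⟨.inr y, (singleton_inr_mem_join hK).2 hy, ?_⟩
        rw [deletion_join_inr]
        exact hD.join_right hK

/-- The link of a face in a complex. -/
def faceLink (K : Set (Finset α)) (s : Finset α) : Set (Finset α) :=
  {t | Disjoint s t ∧ s ∪ t ∈ K}

theorem IsComplex.faceLink {K : Set (Finset α)} (hK : IsComplex K) {s : Finset α} (hs : s ∈ K) :
    IsComplex (faceLink K s) where
  empty_mem := ⟨by simp, by simpa using hs⟩
  mem_of_subset ht hst := ⟨ht.1.mono_right hst,
    hK.mem_of_subset ht.2 (Finset.union_subset_union_right hst)⟩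

theorem faceLink_link {K : Set (Finset α)} {x : α} {s : Finset α} (hx : x ∉ s) :
    faceLink (link K x) s = faceLink K (insert x s) := by
  ext t
  simp [faceLink, link, hx]
  tauto

/-- The link of a face is an iterated vertex link, and each vertex lowers the index by one. -/
theorem IsSphereComplex.faceLink {n : ℕ} {K : Set (Finset α)} (hK : IsComplex K)
    (h : IsSphereComplex n K) {s : Finset α} (hs : s ∈ K) :
    ∃ m, s.card + m = n ∧ IsSphereComplex m (faceLink K s) := by
  induction s using Finset.induction generalizing n K with
  | empty => exact ⟨n, by simp, by simpa [KnillGraph.faceLink] using h⟩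
  | insert x s hxs ih =>
    have hx : {x} ∈ K := hK.mem_of_subset hs (by simp)
    match n with
    | 0 =>
      have h : K = {∅} := h
      simp [h] at hs
    | n + 1 =>
      obtain ⟨m, hm, h⟩ := ih (hK.link hx) (h.1 x hx) ⟨hxs, hs⟩
      exact ⟨m, by rw [Finset.card_insert_of_notMem hxs]; omega, faceLink_link hxs ▸ h⟩

/-- The complex of cliques of `G` with vertices in `s`. -/
def cliqueComplex (G : SimpleGraph α) (s : Set α) : Set (Finset α) :=
  {t | (t : Set α) ⊆ s ∧ G.IsClique t}

omit [DecidableEq α] in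
theorem isComplex_cliqueComplex (G : SimpleGraph α) (s : Set α) :
    IsComplex (cliqueComplex G s) where
  empty_mem := by simp [cliqueComplex]
  mem_of_subset ht hst := ⟨(Finset.coe_subset.2 hst).trans ht.1,
    ht.2.subset (Finset.coe_subset.2 hst)⟩

omit [DecidableEq α] in
theorem singleton_mem_cliqueComplex {G : SimpleGraph α} {s : Set α} {x : α} :
    {x} ∈ cliqueComplex G s ↔ x ∈ s := by
  simp [cliqueComplex]

/-- Together with `deletion_cliqueComplex` this matches the recursion for complexes with the one for
graphs. -/
theorem link_cliqueComplex {G : SimpleGraph α} {s : Set α} {x : α} (hx : x ∈ s) :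
    link (cliqueComplex G s) x = cliqueComplex G (s ∩ G.neighborSet x) := by
  ext t
  simp only [link, cliqueComplex, mem_ofPred_eq, Finset.coe_insert, insert_subset_iff, hx,
    true_and, subset_inter_iff]
  constructor
  · rintro ⟨hxt, ht, hc⟩
    exact ⟨⟨ht, fun y hy => hc (.inl rfl) (.inr hy) fun h => hxt (h ▸ hy)⟩,
      hc.subset (subset_insert _ _)⟩
  · rintro ⟨⟨ht, hN⟩, hc⟩
    exact ⟨fun h => G.loopless.irrefl _ (hN h), ht, hc.insert fun y hy _ => hN hy⟩

omit [DecidableEq α] in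
theorem deletion_cliqueComplex (G : SimpleGraph α) (s : Set α) (x : α) :
    deletion (cliqueComplex G s) x = cliqueComplex G (s \ {x}) := by
  ext t
  simp only [deletion, cliqueComplex, mem_ofPred_eq, subset_sdiff, disjoint_singleton_right,
    Finset.mem_coe]
  tauto

theorem ContractibleOn.nonevasive {G : SimpleGraph α} {s : Set α} (h : ContractibleOn G s) :
    Nonevasive (cliqueComplex G s) := by
  induction h with
  | point x =>
    have : cliqueComplex G {x} = {∅, {x}} := by
      ext t
      have : t = {x} → G.IsClique t := by rintro rfl; simp
      have : t = ∅ → G.IsClique t := by rintro rfl; simp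
      simp only [cliqueComplex, mem_ofPred_eq, Finset.coe_subset_singleton,
        Finset.subset_singleton_iff, mem_insert_iff, mem_singleton_iff]
      tauto
    exact this ▸ .point x
  | step s x hx _ _ ihS ihD =>
    refine .step _ x (singleton_mem_cliqueComplex.2 hx) ?_ ?_
    · rwa [link_cliqueComplex hx]
    · rwa [deletion_cliqueComplex]

theorem SphereOn.isSphereComplex {G : SimpleGraph α} {n : ℕ} {s : Set α} (h : SphereOn G n s) :
    IsSphereComplex n (cliqueComplex G s) := by
  induction n generalizing s with
  | zero =>
    have h : s = ∅ := h
    subst h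
    change _ = _
    ext t
    have : t = ∅ → G.IsClique t := by rintro rfl; simp
    simpa [cliqueComplex, subset_empty_iff] using this
  | succ n ih =>
    obtain ⟨hS, x, hx, hD⟩ := h
    refine ⟨fun y hy => ?_, x, singleton_mem_cliqueComplex.2 hx, ?_⟩
    · rw [singleton_mem_cliqueComplex] at hy
      rw [link_cliqueComplex hy]
      exact ih (hS y hy)
    · rw [deletion_cliqueComplex]
      exact hD.nonevasive

/-- The clique complex of a manifold need not be a sphere, but its link at a vertex `x` of `s` is
one, and the link of `s` is the link of `s.erase x` inside it. -/
theorem exists_isSphereComplex_faceLink {G : SimpleGraph α} {d : ℕ}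
    (h : ∀ x, SphereOn G d (G.neighborSet x)) {s : Finset α} (hs : s.Nonempty)
    (hc : G.IsClique s) :
    ∃ m, s.card + m = d + 1 ∧ IsSphereComplex m (faceLink (cliqueComplex G univ) s) := by
  obtain ⟨x, hx⟩ := hs
  have hK := isComplex_cliqueComplex G univ
  have hs : s ∈ cliqueComplex G univ := ⟨subset_univ _, hc⟩
  have hx' : {x} ∈ cliqueComplex G univ := hK.mem_of_subset hs (by simpa using hx)
  have hl : IsSphereComplex d (link (cliqueComplex G univ) x) := by
    rw [link_cliqueComplex (mem_univ x), univ_inter]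
    exact (h x).isSphereComplex
  obtain ⟨m, hm, h⟩ := hl.faceLink (hK.link hx') (IsComplex.erase_mem_link hs hx)
  rw [faceLink_link (Finset.notMem_erase x s), Finset.insert_erase hx] at h
  exact ⟨m, by rw [Finset.card_erase_of_mem hx] at hm; have := Finset.card_pos.2 ⟨x, hx⟩; omega, h⟩

end Complex

/-! ### Barycentric subdivision of complexes -/

section Subdivision

variable {α : Type*}

/-- The nonempty faces of a complex. -/
def faces (K : Set (Finset α)) : Set (Finset α) :=
  {t ∈ K | t.Nonempty}

section Image

variable {P Q : Type*} [PartialOrder P] [PartialOrder Q] {s : Set P} {f : P → Q}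

theorem ContractibleOn.image_of_le_iff (h : ContractibleOn (comparabilityGraph P) s)
    (hf : ∀ a ∈ s, ∀ b ∈ s, (f a ≤ f b ↔ a ≤ b)) :
    ContractibleOn (comparabilityGraph Q) (f '' s) := by
  refine h.image (fun a ha b hb hab => ?_) fun a ha b hb => ?_
  · exact le_antisymm ((hf a ha b hb).1 hab.le) ((hf b hb a ha).1 hab.ge)
  · simp only [comparabilityGraph, lt_iff_le_not_ge, hf a ha b hb, hf b hb a ha]

theorem SphereOn.image_of_le_iff {n : ℕ} (h : SphereOn (comparabilityGraph P) n s)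
    (hf : ∀ a ∈ s, ∀ b ∈ s, (f a ≤ f b ↔ a ≤ b)) :
    SphereOn (comparabilityGraph Q) n (f '' s) := by
  refine h.image (fun a ha b hb hab => ?_) fun a ha b hb => ?_
  · exact le_antisymm ((hf a ha b hb).1 hab.le) ((hf b hb a ha).1 hab.ge)
  · simp only [comparabilityGraph, lt_iff_le_not_ge, hf a ha b hb, hf b hb a ha]

/-- Reversing an order does not change its comparability graph; this serves the complementation in
`lower_cliquePairs`. -/
theorem SphereOn.image_of_ge_iff {n : ℕ} (h : SphereOn (comparabilityGraph P) n s)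
    (hf : ∀ a ∈ s, ∀ b ∈ s, (f a ≤ f b ↔ b ≤ a)) :
    SphereOn (comparabilityGraph Q) n (f '' s) := by
  refine h.image (fun a ha b hb hab => ?_) fun a ha b hb => ?_
  · exact le_antisymm ((hf b hb a ha).1 hab.ge) ((hf a ha b hb).1 hab.le)
  · simp only [comparabilityGraph, lt_iff_le_not_ge, hf a ha b hb, hf b hb a ha, or_comm]

end Image

variable [DecidableEq α] [Finite α]

/-- The faces `t ≠ {x}` containing `x` can be removed in increasing order, leaving the faces of the
deletion: what remains below `t` has the greatest element `t.erase x` and is thus a cone. -/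
theorem contractibleOn_faces_diff_singleton {K : Set (Finset α)} (hK : IsComplex K) {x : α}
    (h : ContractibleOn (comparabilityGraph (Finset α)) (faces (deletion K x))) :
    ContractibleOn (comparabilityGraph (Finset α)) (faces K \ {{x}}) := by
  have hdiff : (faces K \ {{x}}) \ {t ∈ faces K \ {{x}} | x ∈ t} = faces (deletion K x) := by
    ext t
    have : t = {x} → x ∈ t := by rintro rfl; simp
    simp only [faces, deletion, mem_sdiff, mem_ofPred_eq, mem_singleton_iff]
    tauto
  refine .of_diff (r := {t ∈ faces K \ {{x}} | x ∈ t}) (sep_subset _ _) ?_ (hdiff ▸ h)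
  rintro t ⟨⟨⟨htK, -⟩, htx⟩, hxt⟩
  rw [hdiff]
  refine contractibleOn_of_cone (a := t.erase x) (toFinite _) ⟨⟨⟨by simp, ?_⟩, ?_⟩, ?_⟩ ?_
  · exact hK.mem_of_subset htK (Finset.erase_subset _ _)
  · rw [Finset.nonempty_iff_ne_empty, Ne, Finset.erase_eq_empty_iff]
    rintro (rfl | h)
    exacts [by simp at hxt, htx h]
  · exact Finset.erase_ssubset hxt
  · rintro y ⟨⟨⟨hxy, -⟩, -⟩, hyt⟩ hne
    exact .inr (lt_of_le_of_ne (Finset.subset_erase.2 ⟨hyt.1, hxy⟩) hne)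

omit [Finite α] in
theorem image_insert_faces_link (K : Set (Finset α)) (x : α) :
    insert x '' faces (link K x) = {t ∈ faces K | {x} < t} := by
  ext t
  constructor
  · rintro ⟨s, ⟨⟨hxs, hs⟩, hne⟩, rfl⟩
    refine ⟨⟨hs, by simp⟩, by simp, fun h => ?_⟩
    obtain ⟨y, hy⟩ := hne
    have := h (Finset.mem_insert_of_mem hy)
    rw [Finset.mem_singleton] at this
    exact hxs (this ▸ hy)
  · rintro ⟨⟨htK, -⟩, hxt⟩
    have hx : x ∈ t := by simpa using hxt.1
    refine ⟨t.erase x, ⟨IsComplex.erase_mem_link htK hx, ?_⟩, Finset.insert_erase hx⟩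
    rw [Finset.nonempty_iff_ne_empty, Ne, Finset.erase_eq_empty_iff]
    rintro (rfl | h)
    exacts [by simp at hx, hxt.ne' h]

omit [Finite α] in
theorem insert_le_insert_iff_of_mem_link {K : Set (Finset α)} {x : α} :
    ∀ s ∈ faces (link K x), ∀ t ∈ faces (link K x), (insert x s ≤ insert x t ↔ s ≤ t) :=
  fun _ hs _ _ => Finset.insert_subset_insert_iff hs.1.1

/-- The face `{x}` is minimal, so its unit sphere consists of the faces above it, a copy of the face
poset of the link of `x`. -/
theorem Nonevasive.contractibleOn_faces {K : Set (Finset α)} (h : Nonevasive K)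
    (hK : IsComplex K) : ContractibleOn (comparabilityGraph (Finset α)) (faces K) := by
  induction h with
  | point x =>
    have : faces {∅, {x}} = {{x}} := by
      ext t
      simp only [faces, mem_ofPred_eq, mem_insert_iff, mem_singleton_iff]
      constructor
      · rintro ⟨rfl | h, hn⟩
        exacts [by simp at hn, h]
      · rintro rfl
        simp
    rw [this]
    exact .point _
  | step K x hx _ _ ihS ihD =>
    refine .step _ {x} ⟨hx, by simp⟩ ?_
      (contractibleOn_faces_diff_singleton hK (ihD (hK.deletion x)))
    have hl : {t ∈ faces K | t < {x}} = ∅ := by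
      ext t
      simp only [faces, mem_ofPred_eq, mem_empty_iff_false, iff_false]
      rintro ⟨⟨-, hn⟩, ht⟩
      exact hn.ne_empty (Finset.ssubset_singleton_iff.1 ht)
    rw [inter_neighborSet_comparabilityGraph, hl, empty_union, ← image_insert_faces_link]
    exact (ihS (hK.link hx)).image_of_le_iff insert_le_insert_iff_of_mem_link

omit [Finite α] in
theorem union_le_union_iff_of_mem_faceLink {K : Set (Finset α)} {s t : Finset α}
    (ht : t ∈ faceLink K s) {u : Finset α} : s ∪ t ≤ s ∪ u ↔ t ≤ u := by
  refine ⟨fun h x hx => ?_, Finset.union_subset_union_right⟩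
  exact (Finset.mem_union.1 (h (Finset.mem_union_right s hx))).resolve_left
    (Finset.disjoint_right.1 ht.1 hx)

/-- The Barycentric subdivision of a sphere is a sphere. -/
theorem IsSphereComplex.sphereOn_faces {n : ℕ} {K : Set (Finset α)} (h : IsSphereComplex n K)
    (hK : IsComplex K) : SphereOn (comparabilityGraph (Finset α)) n (faces K) := by
  induction n using Nat.strong_induction_on generalizing K with
  | _ n ih =>
    match n with
    | 0 =>
      have h : K = {∅} := h
      subst h
      change _ = _
      ext t
      simp only [faces, mem_ofPred_eq, mem_singleton_iff, mem_empty_iff_false, iff_false]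
      rintro ⟨rfl, h⟩
      simp at h
    | n + 1 =>
      refine ⟨fun s hs => ?_, ?_⟩
      -- The unit sphere of `s` is the join of the subdivisions of `∂s`, of index `k = |s| - 1`, and
      -- of the link of `s`, of index `m = n + 1 - |s|`. Both indices are below `n + 1`, whence the
      -- strong induction.
      · obtain ⟨m, hm, hl⟩ := h.faceLink hK hs.1
        obtain ⟨k, hk⟩ : ∃ k, s.card = k + 1 :=
          ⟨_, (Nat.succ_pred_eq_of_pos (Finset.card_pos.2 hs.2)).symm⟩
        have h1 := ih k (by omega) (isSphereComplex_boundary hk) (isComplex_boundary hs.2)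
        have h2 := (ih m (by omega) hl (hK.faceLink hs.1))
        have e1 : {t ∈ faces K | t < s} = faces {t | t ⊂ s} := by
          ext t
          have : t ⊂ s → t ∈ K := fun ht => hK.mem_of_subset hs.1 ht.1
          simp only [faces, mem_ofPred_eq]
          tauto
        have e2 : {t ∈ faces K | s < t} = (s ∪ ·) '' faces (KnillGraph.faceLink K s) := by
          ext t
          constructor
          · rintro ⟨⟨htK, -⟩, hst⟩
            refine ⟨t \ s, ⟨⟨Finset.disjoint_sdiff, ?_⟩, ?_⟩, ?_⟩
            · rwa [Finset.union_sdiff_of_subset hst.1]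
            · exact Finset.sdiff_nonempty.2 hst.2
            · exact Finset.union_sdiff_of_subset hst.1
          · rintro ⟨u, ⟨⟨hd, hu⟩, hne⟩, rfl⟩
            refine ⟨⟨hu, hne.mono Finset.subset_union_right⟩, Finset.subset_union_left, fun h => ?_⟩
            obtain ⟨y, hy⟩ := hne
            exact Finset.disjoint_right.1 hd hy (h (Finset.mem_union_right s hy))
        obtain rfl : k + m = n := by omega
        exact SphereOn.inter_neighborSet (e1 ▸ h1) (e2 ▸ h2.image_of_le_iff fun t ht u _ =>
          union_le_union_iff_of_mem_faceLink ht.1)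
      · obtain ⟨x, hx, hD⟩ := h.2
        exact ⟨{x}, ⟨hx, by simp⟩, contractibleOn_faces_diff_singleton hK
          (hD.contractibleOn_faces (hK.deletion x))⟩

end Subdivision

/-! ### Manifolds: isomorphism invariance and chromatic number -/

section Manifold

variable {V W : Type*} {G : SimpleGraph V} {H : SimpleGraph W}

theorem isManifold_iff_univ [Finite V] (d : ℕ) :
    IsManifold d G ↔ ∀ x, SphereOn G d (G.neighborSet x) := by
  have h : range (SimpleGraph.Embedding.refl : G ↪g G) = univ := range_id
  simpa [h] using isManifold_iff d (SimpleGraph.Embedding.refl : G ↪g G)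

theorem IsManifold.iso {d : ℕ} (h : IsManifold d G) (e : G ≃g H) : IsManifold d H := by
  have := h.1
  have : Finite W := .of_equiv V e.toEquiv
  rw [isManifold_iff d e.toEmbedding] at h
  rw [isManifold_iff_univ]
  have hr : range e.toEmbedding = univ := e.surjective.range_eq
  simpa [hr] using h

theorem IsManifold.chromaticNumber_eq [Nonempty V] {d : ℕ} (h : IsManifold d G)
    (hc : G.Colorable (d + 1)) : G.chromaticNumber = ((d + 1 : ℕ) : ℕ∞) := by
  classical
  have := h.1
  obtain ⟨x⟩ := ‹Nonempty V›
  obtain ⟨t, hts, ht⟩ := ((isManifold_iff_univ d).1 h x).exists_isClique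
  have hi : G.IsNClique (d + 1) (insert x t) := ht.insert fun y hy => hts hy
  exact le_antisymm hc.chromaticNumber_le (hi.2 ▸ hi.1.card_le_chromaticNumber)

end Manifold

/-! ### The product of two manifolds -/

section Product

variable {V W : Type*} (A : SimpleGraph V) (B : SimpleGraph W)

/-- The pairs of nonempty cliques. -/
def cliquePairs : Set (Finset V × Finset W) :=
  {a | (a.1.Nonempty ∧ A.IsClique a.1) ∧ (a.2.Nonempty ∧ B.IsClique a.2)}

/-- The product graph is a comparability graph. -/
def cartesianProductEmbedding :
    cartesianProduct A B ↪g comparabilityGraph (Finset V × Finset W) where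
  toFun a := (a.1.1, a.2.1)
  inj' a b h := Prod.ext (Subtype.ext (Prod.ext_iff.1 h).1) (Subtype.ext (Prod.ext_iff.1 h).2)
  map_rel_iff' {a b} := by
    have hne : (a.1.1, a.2.1) = (b.1.1, b.2.1) ↔ a = b := by
      simp [Prod.ext_iff, Subtype.ext_iff]
    change (((a.1.1, a.2.1) : Finset V × Finset W) < (b.1.1, b.2.1) ∨
      ((b.1.1, b.2.1) : Finset V × Finset W) < (a.1.1, a.2.1)) ↔ _ ∧ _
    simp only [lt_iff_le_and_ne, Prod.mk_le_mk, ne_eq, hne, eq_comm (a := (b.1.1, b.2.1))]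
    tauto

theorem range_cartesianProductEmbedding :
    range (cartesianProductEmbedding A B) = cliquePairs A B := by
  ext ⟨x, y⟩
  constructor
  · rintro ⟨a, h⟩
    obtain ⟨rfl, rfl⟩ := Prod.ext_iff.1 h
    exact ⟨a.1.2, a.2.2⟩
  · rintro ⟨hx, hy⟩
    exact ⟨(⟨x, hx⟩, ⟨y, hy⟩), rfl⟩

theorem le_iff_toLeft_toRight {t u : Finset (V ⊕ W)} :
    t ≤ u ↔ t.toLeft ≤ u.toLeft ∧ t.toRight ≤ u.toRight :=
  (Finset.sumEquiv.le_iff_le (x := t) (y := u)).symm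

theorem disjSum_nonempty_iff {s : Finset V} {t : Finset W} :
    (s.disjSum t).Nonempty ↔ s.Nonempty ∨ t.Nonempty := by
  simp only [Finset.nonempty_iff_ne_empty, Ne, Finset.disjSum_eq_empty]
  tauto

variable {A B} [DecidableEq V] [DecidableEq W]

/-- Complements turn "both components nonempty" into "both proper" and "not the top pair" into "not
the empty face", which describes the nonempty faces of `∂x * ∂y`. -/
theorem lower_cliquePairs {x : Finset V} {y : Finset W} (h : (x, y) ∈ cliquePairs A B) :
    {a ∈ cliquePairs A B | a < (x, y)} =
      (fun t : Finset (V ⊕ W) => (x \ t.toLeft, y \ t.toRight)) ''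
        faces (join {t | t ⊂ x} {t | t ⊂ y}) := by
  ext ⟨u, v⟩
  constructor
  · rintro ⟨⟨⟨hu, -⟩, ⟨hv, -⟩⟩, ⟨hux, hvy⟩, hn⟩
    have hux : u ⊆ x := hux
    have hvy : v ⊆ y := hvy
    refine ⟨(x \ u).disjSum (y \ v), ⟨⟨?_, ?_⟩, ?_⟩, ?_⟩
    · rw [Finset.toLeft_disjSum]
      exact Finset.sdiff_ssubset hux hu
    · rw [Finset.toRight_disjSum]
      exact Finset.sdiff_ssubset hvy hv
    · rw [disjSum_nonempty_iff, Finset.sdiff_nonempty, Finset.sdiff_nonempty]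
      by_contra! hc
      exact hn hc
    · simp [Finset.inter_eq_right.2 hux, Finset.inter_eq_right.2 hvy]
  · rintro ⟨t, ⟨⟨hl, hr⟩, hne⟩, he⟩
    obtain ⟨rfl, rfl⟩ := Prod.ext_iff.1 he
    have hl : t.toLeft ⊂ x := hl
    have hr : t.toRight ⊂ y := hr
    refine ⟨⟨⟨Finset.sdiff_nonempty.2 hl.2, h.1.2.subset ?_⟩, Finset.sdiff_nonempty.2 hr.2,
      h.2.2.subset ?_⟩, ⟨Finset.sdiff_subset, Finset.sdiff_subset⟩, fun hle => ?_⟩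
    · exact Finset.coe_subset.2 Finset.sdiff_subset
    · exact Finset.coe_subset.2 Finset.sdiff_subset
    · rw [← Finset.toLeft_disjSum_toRight (u := t), disjSum_nonempty_iff] at hne
      rcases hne with ⟨z, hz⟩ | ⟨z, hz⟩
      · exact (Finset.mem_sdiff.1 (hle.1 (hl.1 hz))).2 hz
      · exact (Finset.mem_sdiff.1 (hle.2 (hr.1 hz))).2 hz

theorem upper_cliquePairs {x : Finset V} {y : Finset W} (h : (x, y) ∈ cliquePairs A B) :
    {a ∈ cliquePairs A B | (x, y) < a} =
      (fun t : Finset (V ⊕ W) => (x ∪ t.toLeft, y ∪ t.toRight)) ''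
        faces (join (faceLink (cliqueComplex A univ) x) (faceLink (cliqueComplex B univ) y)) := by
  ext ⟨u, v⟩
  constructor
  · rintro ⟨⟨⟨-, hu⟩, ⟨-, hv⟩⟩, ⟨hux, hvy⟩, hn⟩
    have hux : x ⊆ u := hux
    have hvy : y ⊆ v := hvy
    refine ⟨(u \ x).disjSum (v \ y), ⟨⟨?_, ?_⟩, ?_⟩, ?_⟩
    · rw [Finset.toLeft_disjSum]
      exact ⟨Finset.disjoint_sdiff, subset_univ _, by rwa [Finset.union_sdiff_of_subset hux]⟩
    · rw [Finset.toRight_disjSum]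
      exact ⟨Finset.disjoint_sdiff, subset_univ _, by rwa [Finset.union_sdiff_of_subset hvy]⟩
    · rw [disjSum_nonempty_iff, Finset.sdiff_nonempty, Finset.sdiff_nonempty]
      by_contra! hc
      exact hn hc
    · simp [Finset.union_eq_right.2 hux, Finset.union_eq_right.2 hvy]
  · rintro ⟨t, ⟨⟨hl, hr⟩, hne⟩, he⟩
    obtain ⟨rfl, rfl⟩ := Prod.ext_iff.1 he
    refine ⟨⟨⟨h.1.1.mono Finset.subset_union_left, hl.2.2⟩,
      h.2.1.mono Finset.subset_union_left, hr.2.2⟩,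
      ⟨Finset.subset_union_left, Finset.subset_union_left⟩, fun hle => ?_⟩
    rw [← Finset.toLeft_disjSum_toRight (u := t), disjSum_nonempty_iff] at hne
    rcases hne with ⟨z, hz⟩ | ⟨z, hz⟩
    · exact Finset.disjoint_right.1 hl.1 hz (hle.1 (Finset.mem_union_right _ hz))
    · exact Finset.disjoint_right.1 hr.1 hz (hle.2 (Finset.mem_union_right _ hz))

omit [DecidableEq V] [DecidableEq W] in
theorem IsManifold.cartesianProduct {p q : ℕ} (hA : IsManifold p A) (hB : IsManifold q B) :
    IsManifold (p + q) (cartesianProduct A B) := by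
  classical
  have := hA.1
  have := hB.1
  rw [isManifold_iff_univ] at hA hB
  rw [isManifold_iff _ (cartesianProductEmbedding A B), range_cartesianProductEmbedding]
  rintro ⟨x, y⟩ h
  obtain ⟨m, hm, hx⟩ := exists_isSphereComplex_faceLink hA h.1.1 h.1.2
  obtain ⟨n, hn, hy⟩ := exists_isSphereComplex_faceLink hB h.2.1 h.2.2
  obtain ⟨k, hk⟩ : ∃ k, x.card = k + 1 :=
    ⟨_, (Nat.succ_pred_eq_of_pos (Finset.card_pos.2 h.1.1)).symm⟩
  obtain ⟨l, hl⟩ : ∃ l, y.card = l + 1 :=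
    ⟨_, (Nat.succ_pred_eq_of_pos (Finset.card_pos.2 h.2.1)).symm⟩
  have hcx := isComplex_boundary h.1.1
  have hcy := isComplex_boundary h.2.1
  have hlx := (isComplex_cliqueComplex A univ).faceLink (s := x) ⟨subset_univ _, h.1.2⟩
  have hly := (isComplex_cliqueComplex B univ).faceLink (s := y) ⟨subset_univ _, h.2.2⟩
  have hlow := ((isSphereComplex_boundary hk).join hcx hcy
    (isSphereComplex_boundary hl)).sphereOn_faces (hcx.join hcy)
  have hupp := (hx.join hlx hly hy).sphereOn_faces (hlx.join hly)
  obtain rfl : k + m = p := by change x.card + m = p + 1 at hm; omega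
  obtain rfl : l + n = q := by change y.card + n = q + 1 at hn; omega
  -- Regrouping: the part below has index `k + l`, from the two boundaries, and the part above has
  -- index `m + n`, from the two links.
  rw [show k + m + (l + n) = k + l + (m + n) by omega]
  refine SphereOn.inter_neighborSet ?_ ?_
  · rw [lower_cliquePairs h]
    refine hlow.image_of_ge_iff fun t ht u hu => ?_
    rw [le_iff_toLeft_toRight, Prod.mk_le_mk]
    exact and_congr (sdiff_le_sdiff_iff_le ht.1.1.1 hu.1.1.1)
      (sdiff_le_sdiff_iff_le ht.1.2.1 hu.1.2.1)
  · rw [upper_cliquePairs h]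
    refine hupp.image_of_le_iff fun t ht u _ => ?_
    rw [le_iff_toLeft_toRight, Prod.mk_le_mk]
    exact and_congr (union_le_union_iff_of_mem_faceLink ht.1.1)
      (union_le_union_iff_of_mem_faceLink ht.1.2)

omit [DecidableEq V] in
theorem IsManifold.card_le {p : ℕ} (hA : IsManifold p A)
    (x : CompleteSubgraph A) : x.1.card ≤ p + 1 := by
  classical
  have := hA.1
  obtain ⟨m, hm, -⟩ :=
    exists_isSphereComplex_faceLink ((isManifold_iff_univ p).1 hA) x.2.1 x.2.2
  omega

omit [DecidableEq V] [DecidableEq W] in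
theorem IsManifold.colorable_cartesianProduct {p q : ℕ} (hA : IsManifold p A)
    (hB : IsManifold q B) : (KnillGraph.cartesianProduct A B).Colorable (p + q + 1) := by
  classical
  -- The color is the total dimension of the pair; both cliques are nonempty, so the subtraction of
  -- `2` never truncates.
  have hlt (a : CompleteSubgraph A × CompleteSubgraph B) :
      a.1.1.card + a.2.1.card - 2 < p + q + 1 := by
    have := hA.card_le a.1
    have := hB.card_le a.2
    omega
  have key (a b : CompleteSubgraph A × CompleteSubgraph B) (hne : a ≠ b) (h1 : a.1.1 ⊆ b.1.1)
      (h2 : a.2.1 ⊆ b.2.1) :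
      a.1.1.card + a.2.1.card - 2 ≠ b.1.1.card + b.2.1.card - 2 := by
    intro h
    have := Finset.card_pos.2 a.1.2.1
    have := Finset.card_pos.2 a.2.2.1
    have := Finset.card_le_card h1
    have := Finset.card_le_card h2
    exact hne (Prod.ext (Subtype.ext (Finset.eq_of_subset_of_card_le h1 (by omega)))
      (Subtype.ext (Finset.eq_of_subset_of_card_le h2 (by omega))))
  refine ⟨SimpleGraph.Coloring.mk (fun a => ⟨_, hlt a⟩) ?_⟩
  rintro a b ⟨hne, h | h⟩ heq
  · exact key a b hne h.1 h.2 (Fin.mk.inj_iff.1 heq)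
  · exact key b a hne.symm h.1 h.2 (Fin.mk.inj_iff.1 heq).symm

end Product

/-! ### Barycentric refinement as the product with a point -/

section Point

theorem isManifold_point : IsManifold 0 (⊥ : SimpleGraph PUnit.{1}) :=
  ⟨inferInstance, fun _ => ⟨fun y => y.2⟩⟩

instance : Unique (CompleteSubgraph (⊥ : SimpleGraph PUnit.{1})) where
  default := ⟨{⟨⟩}, by simp⟩
  uniq a := Subtype.ext (Finset.eq_singleton_iff_nonempty_unique_mem.2 ⟨a.2.1, fun _ _ => rfl⟩)

/-- The product with a point is the Barycentric refinement. -/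
def cartesianProductPointIso {V : Type*} (G : SimpleGraph V) :
    cartesianProduct G (⊥ : SimpleGraph PUnit.{1}) ≃g barycentricRefinement G where
  toEquiv := Equiv.prodUnique _ _
  map_rel_iff' {a b} := by
    have h : a.2 = b.2 := Subsingleton.elim _ _
    simp [barycentricRefinement, cartesianProduct, Prod.ext_iff, h]

end Point

instance {V : Type*} [Nonempty V] (G : SimpleGraph V) : Nonempty (CompleteSubgraph G) :=
  ‹Nonempty V›.map fun x => ⟨{x}, by simp⟩

end KnillGraph

theorem mainTheorem5 :
    (∀ (d : ℕ) {V : Type*} [Nonempty V] (G : SimpleGraph V), KnillGraph.IsManifold d G →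
      KnillGraph.IsManifold d (KnillGraph.barycentricRefinement G) ∧
        (KnillGraph.barycentricRefinement G).chromaticNumber = ((d + 1 : ℕ) : ℕ∞)) ∧
    (∀ (p q : ℕ) {V W : Type*} [Nonempty V] [Nonempty W]
      (A : SimpleGraph V) (B : SimpleGraph W),
      KnillGraph.IsManifold p A → KnillGraph.IsManifold q B →
      KnillGraph.IsManifold (p + q) (KnillGraph.cartesianProduct A B) ∧
        (KnillGraph.cartesianProduct A B).chromaticNumber = ((p + q + 1 : ℕ) : ℕ∞)) := by
  constructor
  · intro d V _ G hG
    -- The point has dimension `0`, and `d + 0` is `d` by definition.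
    have e := KnillGraph.cartesianProductPointIso G
    have hM := (hG.cartesianProduct KnillGraph.isManifold_point).iso e
    have hC := hG.colorable_cartesianProduct KnillGraph.isManifold_point
    exact ⟨hM, hM.chromaticNumber_eq (hC.of_hom e.symm.toHom)⟩
  · intro p q V W _ _ A B hA hB
    have hM := hA.cartesianProduct hB
    exact ⟨hM, hM.chromaticNumber_eq (hA.colorable_cartesianProduct hB)⟩
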